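/- Let $M$ be a smooth manifold of dimension $2n+1$ ($n\ge 0$) and let $r\in\{1,-1\}$. Let $(\varphi,\xi,\eta,g)$ be an $[r]$-Sasakian structure on $M$: $\varphi$ is a smooth $(1,1)$-tensor field, $\xi$ a smooth vector field, $\eta$ a smooth $1$-form and $g$ a smooth symmetric non-degenerate $(0,2)$-tensor field (of arbitrary signature) with Levi-Civita connection $\nabla$, such that for some constant $\varepsilon\in\{1,-1\}$ and all smooth vector fields $X,Y$ on $M$ $$g(\xi,\xi)=\varepsilon,\qquad \varphi^2=r(-I+\eta\otimes\xi),\qquad \eta(\xi)=1,$$ $$g(\varphi X,\varphi Y)=r\bigl(g(X,Y)-\varepsilon\,\eta(X)\eta(Y)\bigr),\qquad (\nabla_X\varphi)(Y)=r\bigl(g(X,Y)\,\xi-\varepsilon\,\eta(Y)X\bigr).$$ (For $r=1$ this is an indefinite Sasakian structure, for $r=-1$ a paraSasakian structure.) Let $R(X,Y)Z=\nabla_X\nabla_YZ-\nabla_Y\nabla_XZ-\nabla_{[X,Y]}Z$ be the curvature tensor and let $\rho(X,Y)=\operatorname{tr}\{Z\mapsto R(Z,X)Y\}$ be the Ricci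 tensor of $g$. Then $$\rho(X,\xi)=2nr\,\eta(X)$$ for every smooth vector field $X$ on $M$. -/

import Mathlib

open Bundle Module Set VectorField
open scoped Manifold ContDiff Topology

noncomputable section

section

variable {E : Type*} [NormedAddCommGroup E] [NormedSpace ℝ E]
  {H : Type*} [TopologicalSpace H] (I : ModelWithCorners ℝ E H)
  (M : Type*) [TopologicalSpace M] [ChartedSpace H M] [IsManifold I ∞ M]

/-- A metric tensor field on `M`: a smooth, symmetric, non-degenerate `(0,2)`-tensor field,
of arbitrary signature. -/
structure SemiRiemannianMetric where
  /-- The bilinear form on the tangent space at `x`. -/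
  inner (x : M) : TangentSpace I x →L[ℝ] TangentSpace I x →L[ℝ] ℝ
  symm (x : M) (v w : TangentSpace I x) : inner x v w = inner x w v
  nondegenerate (x : M) (v : TangentSpace I x) (hv : ∀ w, inner x v w = 0) : v = 0
  contMDiff : ContMDiff I (I.prod 𝓘(ℝ, E →L[ℝ] E →L[ℝ] ℝ)) ∞
    (fun x ↦ TotalSpace.mk' (E →L[ℝ] E →L[ℝ] ℝ) x (inner x))

end

namespace SemiRiemannianMetric

variable {E : Type*} [NormedAddCommGroup E] [NormedSpace ℝ E]
  {H : Type*} [TopologicalSpace H] {I : ModelWithCorners ℝ E H}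
  {M : Type*} [TopologicalSpace M] [ChartedSpace H M] [IsManifold I ∞ M]
  (g : SemiRiemannianMetric I M)

lemma mdifferentiableAt_inner {X Y : Π x : M, TangentSpace I x} {x : M}
    (hX : MDiffAt (T% X) x) (hY : MDiffAt (T% Y) x) :
    MDiffAt (fun y ↦ g.inner y (X y) (Y y)) x := by
  have : MDifferentiableAt I (I.prod 𝓘(ℝ))
      (fun m ↦ TotalSpace.mk' ℝ (E := Bundle.Trivial M ℝ) m (g.inner m (X m) (Y m))) x := by
    apply MDifferentiableAt.clm_bundle_apply₂ (F₁ := E) (F₂ := E)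
    · exact g.contMDiff.mdifferentiableAt (by simp)
    · exact hX
    · exact hY
  simp only [mdifferentiableAt_totalSpace] at this
  exact this.2

/-- Half of the right-hand side of the Koszul formula:
`2 g(∇_X Y, Z) = X g(Y,Z) + Y g(Z,X) - Z g(X,Y) + g([X,Y],Z) - g([Y,Z],X) + g([Z,X],Y)`. -/
def koszul (X Y Z : Π x : M, TangentSpace I x) (x : M) : ℝ :=
  (1 / 2) * (d% (fun y ↦ g.inner y (Y y) (Z y)) x (X x)
    + d% (fun y ↦ g.inner y (Z y) (X y)) x (Y x)
    - d% (fun y ↦ g.inner y (X y) (Y y)) x (Z x)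
    + g.inner x (mlieBracket I X Y x) (Z x)
    - g.inner x (mlieBracket I Y Z x) (X x)
    + g.inner x (mlieBracket I Z X x) (Y x))

variable [FiniteDimensional ℝ E]

lemma koszul_tensorial_left {Y Z : Π x : M, TangentSpace I x} {x : M}
    (hY : MDiffAt (T% Y) x) (hZ : MDiffAt (T% Z) x) :
    TensorialAt I E (fun X ↦ g.koszul X Y Z x) x where
  smul {f X} hf hX := by
    have h1 : d% (fun y ↦ g.inner y (Z y) ((f • X) y)) x
        = f x • d% (fun y ↦ g.inner y (Z y) (X y)) x + g.inner x (Z x) (X x) • d% f x := by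
      rw [← mvfderiv_mul hf (g.mdifferentiableAt_inner hZ hX)]
      congr 1; ext y; simp
    have h2 : d% (fun y ↦ g.inner y ((f • X) y) (Y y)) x
        = f x • d% (fun y ↦ g.inner y (X y) (Y y)) x + g.inner x (X x) (Y x) • d% f x := by
      rw [← mvfderiv_mul hf (g.mdifferentiableAt_inner hX hY)]
      congr 1; ext y; simp
    simp only [koszul, h1, h2, mlieBracket_smul_left hf hX, mlieBracket_smul_right hf hX]
    simp [g.symm x (Z x) (X x)]
    ring
  add {X X'} hX hX' := by
    have h1 : d% (fun y ↦ g.inner y (Z y) ((X + X') y)) x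
        = d% (fun y ↦ g.inner y (Z y) (X y)) x + d% (fun y ↦ g.inner y (Z y) (X' y)) x := by
      rw [← mvfderiv_add (g.mdifferentiableAt_inner hZ hX) (g.mdifferentiableAt_inner hZ hX')]
      congr 1; ext y; simp
    have h2 : d% (fun y ↦ g.inner y ((X + X') y) (Y y)) x
        = d% (fun y ↦ g.inner y (X y) (Y y)) x + d% (fun y ↦ g.inner y (X' y) (Y y)) x := by
      rw [← mvfderiv_add (g.mdifferentiableAt_inner hX hY) (g.mdifferentiableAt_inner hX' hY)]
      congr 1; ext y; simp
    simp only [koszul, h1, h2, mlieBracket_add_left hX hX', mlieBracket_add_right hX hX']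
    simp
    ring

lemma koszul_tensorial_right {X Y : Π x : M, TangentSpace I x} {x : M}
    (hX : MDiffAt (T% X) x) (hY : MDiffAt (T% Y) x) :
    TensorialAt I E (fun Z ↦ g.koszul X Y Z x) x where
  smul {f Z} hf hZ := by
    have h1 : d% (fun y ↦ g.inner y (Y y) ((f • Z) y)) x
        = f x • d% (fun y ↦ g.inner y (Y y) (Z y)) x + g.inner x (Y x) (Z x) • d% f x := by
      rw [← mvfderiv_mul hf (g.mdifferentiableAt_inner hY hZ)]
      congr 1; ext y; simp
    have h2 : d% (fun y ↦ g.inner y ((f • Z) y) (X y)) x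
        = f x • d% (fun y ↦ g.inner y (Z y) (X y)) x + g.inner x (Z x) (X x) • d% f x := by
      rw [← mvfderiv_mul hf (g.mdifferentiableAt_inner hZ hX)]
      congr 1; ext y; simp
    simp only [koszul, h1, h2, mlieBracket_smul_left hf hZ, mlieBracket_smul_right hf hZ]
    simp [g.symm x (Y x) (Z x)]
    ring
  add {Z Z'} hZ hZ' := by
    have h1 : d% (fun y ↦ g.inner y (Y y) ((Z + Z') y)) x
        = d% (fun y ↦ g.inner y (Y y) (Z y)) x + d% (fun y ↦ g.inner y (Y y) (Z' y)) x := by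
      rw [← mvfderiv_add (g.mdifferentiableAt_inner hY hZ) (g.mdifferentiableAt_inner hY hZ')]
      congr 1; ext y; simp
    have h2 : d% (fun y ↦ g.inner y ((Z + Z') y) (X y)) x
        = d% (fun y ↦ g.inner y (Z y) (X y)) x + d% (fun y ↦ g.inner y (Z' y) (X y)) x := by
      rw [← mvfderiv_add (g.mdifferentiableAt_inner hZ hX) (g.mdifferentiableAt_inner hZ' hX)]
      congr 1; ext y; simp
    simp only [koszul, h1, h2, mlieBracket_add_left hZ hZ', mlieBracket_add_right hZ hZ']
    simp
    ring

lemma koszul_add_middle {X Y Y' Z : Π x : M, TangentSpace I x} {x : M}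
    (hX : MDiffAt (T% X) x) (hY : MDiffAt (T% Y) x) (hY' : MDiffAt (T% Y') x)
    (hZ : MDiffAt (T% Z) x) :
    g.koszul X (Y + Y') Z x = g.koszul X Y Z x + g.koszul X Y' Z x := by
  have h1 : d% (fun y ↦ g.inner y ((Y + Y') y) (Z y)) x
      = d% (fun y ↦ g.inner y (Y y) (Z y)) x + d% (fun y ↦ g.inner y (Y' y) (Z y)) x := by
    rw [← mvfderiv_add (g.mdifferentiableAt_inner hY hZ) (g.mdifferentiableAt_inner hY' hZ)]
    congr 1; ext y; simp
  have h2 : d% (fun y ↦ g.inner y (X y) ((Y + Y') y)) x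
      = d% (fun y ↦ g.inner y (X y) (Y y)) x + d% (fun y ↦ g.inner y (X y) (Y' y)) x := by
    rw [← mvfderiv_add (g.mdifferentiableAt_inner hX hY) (g.mdifferentiableAt_inner hX hY')]
    congr 1; ext y; simp
  simp only [koszul, h1, h2, mlieBracket_add_left hY hY', mlieBracket_add_right hY hY']
  simp
  ring

lemma koszul_smul_middle {X Y Z : Π x : M, TangentSpace I x} {f : M → ℝ} {x : M}
    (hX : MDiffAt (T% X) x) (hY : MDiffAt (T% Y) x) (hf : MDiffAt f x)
    (hZ : MDiffAt (T% Z) x) :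
    g.koszul X (f • Y) Z x = f x * g.koszul X Y Z x + d% f x (X x) * g.inner x (Y x) (Z x) := by
  have h1 : d% (fun y ↦ g.inner y ((f • Y) y) (Z y)) x
      = f x • d% (fun y ↦ g.inner y (Y y) (Z y)) x + g.inner x (Y x) (Z x) • d% f x := by
    rw [← mvfderiv_mul hf (g.mdifferentiableAt_inner hY hZ)]
    congr 1; ext y; simp
  have h2 : d% (fun y ↦ g.inner y (X y) ((f • Y) y)) x
      = f x • d% (fun y ↦ g.inner y (X y) (Y y)) x + g.inner x (X x) (Y x) • d% f x := by
    rw [← mvfderiv_mul hf (g.mdifferentiableAt_inner hX hY)]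
    congr 1; ext y; simp
  simp only [koszul, h1, h2, mlieBracket_smul_left hf hY, mlieBracket_smul_right hf hY]
  simp [g.symm x (X x) (Y x)]
  ring

/-- The Koszul expression at `x` as a bilinear form in the values `X x` and `Z x`. -/
def koszulForm (Y : Π x : M, TangentSpace I x) (x : M) (hY : MDiffAt (T% Y) x) :
    TangentSpace I x →L[ℝ] TangentSpace I x →L[ℝ] ℝ :=
  TensorialAt.mkHom₂ (I := I) (F := E) (F' := E) (fun X Z ↦ g.koszul X Y Z x) x
    (fun _ hZ ↦ g.koszul_tensorial_left hY hZ) (fun _ hX ↦ g.koszul_tensorial_right hX hY)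

lemma koszulForm_apply {X Y Z : Π x : M, TangentSpace I x} {x : M}
    (hX : MDiffAt (T% X) x) (hY : MDiffAt (T% Y) x) (hZ : MDiffAt (T% Z) x) :
    g.koszulForm Y x hY (X x) (Z x) = g.koszul X Y Z x :=
  TensorialAt.mkHom₂_apply _ _ hX hZ


/-- The musical isomorphism `v ↦ g(v, ·)` from `T_x M` to its dual. -/
def flat (x : M) : TangentSpace I x ≃L[ℝ] (TangentSpace I x →L[ℝ] ℝ) :=
  haveI : T2Space (TangentSpace I x) := inferInstanceAs (T2Space E)
  haveI : FiniteDimensional ℝ (TangentSpace I x) := inferInstanceAs (FiniteDimensional ℝ E)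
  haveI : FiniteDimensional ℝ (TangentSpace I x →L[ℝ] ℝ) :=
    inferInstanceAs (FiniteDimensional ℝ (E →L[ℝ] ℝ))
  (LinearMap.linearEquivOfInjective
    (g.inner x : TangentSpace I x →ₗ[ℝ] TangentSpace I x →L[ℝ] ℝ)
    ((injective_iff_map_eq_zero _).2 fun v hv ↦ g.nondegenerate x v fun w ↦
      congrArg (fun l : TangentSpace I x →L[ℝ] ℝ ↦ l w) hv)
    (((LinearMap.toContinuousLinearMap (𝕜 := ℝ) (E := TangentSpace I x)
      (F' := ℝ)).finrank_eq.symm.trans Subspace.dual_finrank_eq).symm)).toContinuousLinearEquiv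

lemma flat_apply (x : M) (v w : TangentSpace I x) : g.flat x v w = g.inner x v w := rfl

lemma inner_flat_symm (x : M) (l : TangentSpace I x →L[ℝ] ℝ) (w : TangentSpace I x) :
    g.inner x ((g.flat x).symm l) w = l w := by
  rw [← flat_apply, ContinuousLinearEquiv.apply_symm_apply]

open scoped Classical in
/-- The Levi-Civita connection of `g`, defined by the Koszul formula. In Mathlib's convention
`g.leviCivita Y x (X x)` is `(∇_X Y)(x)`. The lemmas `torsion_leviCivita` and `mvfderiv_inner` below
check that it is torsion-free and metric. -/
def leviCivita : CovariantDerivative I E (TangentSpace I : M → Type _) where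
  toFun Y x := if hY : MDiffAt (T% Y) x then
    ((g.flat x).symm : (TangentSpace I x →L[ℝ] ℝ) →L[ℝ] TangentSpace I x) ∘L g.koszulForm Y x hY
    else 0
  isCovariantDerivativeOnUniv :=
  { add := by
      intro Y Y' x hY hY' _
      have hs : MDiffAt (T% (Y + Y')) x := mdifferentiableAt_add_section hY hY'
      rw [dif_pos hY, dif_pos hY', dif_pos hs]
      ext v
      simp only [ContinuousLinearMap.comp_apply, add_apply, ← map_add]
      congr 1
      ext w
      simp [koszulForm, TensorialAt.mkHom₂_apply_eq_extend, koszul_add_middle, hY, hY',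
        FiberBundle.mdifferentiableAt_extend]
    leibniz := by
      intro Y f x hY hf _
      have hs : MDiffAt (T% (f • Y)) x := hf.smul_section hY
      rw [dif_pos hY, dif_pos hs]
      ext v
      apply (g.flat x).injective
      ext w
      simp [koszulForm, TensorialAt.mkHom₂_apply_eq_extend, koszul_smul_middle, hY, hf,
        FiberBundle.mdifferentiableAt_extend, flat_apply] }

/-- The Koszul formula. -/
lemma inner_leviCivita {X Y Z : Π x : M, TangentSpace I x} {x : M}
    (hX : MDiffAt (T% X) x) (hY : MDiffAt (T% Y) x) (hZ : MDiffAt (T% Z) x) :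
    g.inner x (g.leviCivita Y x (X x)) (Z x) = g.koszul X Y Z x := by
  have : g.leviCivita Y x = ((g.flat x).symm : (TangentSpace I x →L[ℝ] ℝ) →L[ℝ] TangentSpace I x)
      ∘L g.koszulForm Y x hY := dif_pos hY
  rw [this, ContinuousLinearMap.comp_apply, ContinuousLinearEquiv.coe_coe, inner_flat_symm,
    g.koszulForm_apply hX hY hZ]

lemma eq_of_inner {x : M} {v w : TangentSpace I x}
    (h : ∀ Z : Π x : M, TangentSpace I x, MDiffAt (T% Z) x →
      g.inner x v (Z x) = g.inner x w (Z x)) : v = w := by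
  rw [← sub_eq_zero]
  refine g.nondegenerate x _ fun u ↦ ?_
  have := h (FiberBundle.extend E u) (FiberBundle.mdifferentiableAt_extend ..)
  simpa [sub_eq_zero] using this

/-- The Levi-Civita connection is torsion-free. -/
lemma torsion_leviCivita : g.leviCivita.torsion = 0 := by
  rw [CovariantDerivative.torsion_eq_zero_iff]
  intro X Y x hX hY
  refine g.eq_of_inner fun Z hZ ↦ ?_
  have hd (A B : Π x : M, TangentSpace I x) :
      (fun y ↦ g.inner y (A y) (B y)) = fun y ↦ g.inner y (B y) (A y) := by
    ext y; exact g.symm ..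
  rw [map_sub, sub_apply, g.inner_leviCivita hX hY hZ,
    g.inner_leviCivita hY hX hZ, koszul, koszul, hd X Z, hd Z Y, hd Y X,
    mlieBracket_swap_apply (V := Y) (W := X), mlieBracket_swap_apply (V := Z) (W := X),
    mlieBracket_swap_apply (V := Z) (W := Y)]
  simp
  ring

/-- The Levi-Civita connection is metric: `X g(Y,Z) = g(∇_X Y, Z) + g(Y, ∇_X Z)`. -/
lemma mvfderiv_inner {X Y Z : Π x : M, TangentSpace I x} {x : M}
    (hX : MDiffAt (T% X) x) (hY : MDiffAt (T% Y) x) (hZ : MDiffAt (T% Z) x) :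
    d% (fun y ↦ g.inner y (Y y) (Z y)) x (X x) =
      g.inner x (g.leviCivita Y x (X x)) (Z x) + g.inner x (Y x) (g.leviCivita Z x (X x)) := by
  have hd (A B : Π x : M, TangentSpace I x) :
      (fun y ↦ g.inner y (A y) (B y)) = fun y ↦ g.inner y (B y) (A y) := by
    ext y; exact g.symm ..
  rw [g.symm x (Y x), g.inner_leviCivita hX hY hZ, g.inner_leviCivita hX hZ hY, koszul, koszul,
    hd Z Y, hd Y X, hd X Z,
    mlieBracket_swap_apply (V := Y) (W := X), mlieBracket_swap_apply (V := Z) (W := X),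
    mlieBracket_swap_apply (V := Z) (W := Y)]
  simp
  ring

/-- The covariant derivative `∇_X Y` as a vector field. -/
def nabla (X Y : Π x : M, TangentSpace I x) (x : M) : TangentSpace I x :=
  g.leviCivita Y x (X x)

/-- The curvature `R(X,Y)Z = ∇_X ∇_Y Z - ∇_Y ∇_X Z - ∇_[X,Y] Z`. -/
def curvature (X Y Z : Π x : M, TangentSpace I x) (x : M) : TangentSpace I x :=
  g.nabla X (g.nabla Y Z) x - g.nabla Y (g.nabla X Z) x - g.nabla (mlieBracket I X Y) Z x

/-- The Ricci tensor `ρ(X,Y) = tr {Z ↦ R(Z,X)Y}`. The trace at `x` is computed in the local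
coordinate frame `(E_i)` that the chart at `x` induces, as the sum over `i` of the `i`-th
component of `R(E_i,X)Y`. -/
def ricci (X Y : Π x : M, TangentSpace I x) (x : M) : ℝ :=
  ∑ i, (trivializationAt E (TangentSpace I : M → Type _) x).localFrameCoeff I
    (Module.finBasis ℝ E) i x
    (g.curvature ((trivializationAt E (TangentSpace I : M → Type _) x).localFrame
      (Module.finBasis ℝ E) i) X Y x)

end SemiRiemannianMetric

section

variable {E : Type*} [NormedAddCommGroup E] [NormedSpace ℝ E] [FiniteDimensional ℝ E]
  {H : Type*} [TopologicalSpace H] {I : ModelWithCorners ℝ E H}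
  {M : Type*} [TopologicalSpace M] [ChartedSpace H M] [IsManifold I ∞ M]

/-- `(φ, ξ, η, g)` is an `[r]`-Sasakian structure on `M`, with `ε = g(ξ,ξ)`: an indefinite Sasakian
structure for `r = 1`, a paraSasakian structure for `r = -1`. -/
structure IsRSasakian (r ε : ℝ)
    (φ : Cₛ^∞⟮I; E →L[ℝ] E, fun x : M ↦ TangentSpace I x →L[ℝ] TangentSpace I x⟯)
    (ξ : Cₛ^∞⟮I; E, (TangentSpace I : M → Type _)⟯)
    (η : Cₛ^∞⟮I; E →L[ℝ] ℝ, fun x : M ↦ TangentSpace I x →L[ℝ] ℝ⟯)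
    (g : SemiRiemannianMetric I M) : Prop where
  r_eq : r = 1 ∨ r = -1
  ε_eq : ε = 1 ∨ ε = -1
  inner_ξ_ξ (x : M) : g.inner x (ξ x) (ξ x) = ε
  φ_φ (x : M) (v : TangentSpace I x) : φ x (φ x v) = r • (-v + η x v • ξ x)
  η_ξ (x : M) : η x (ξ x) = 1
  inner_φ_φ (x : M) (v w : TangentSpace I x) :
    g.inner x (φ x v) (φ x w) = r * (g.inner x v w - ε * η x v * η x w)
  /-- `(∇_X φ)(Y) = r (g(X,Y) ξ - ε η(Y) X)`, where `(∇_X φ)(Y) = ∇_X (φ Y) - φ (∇_X Y)`. -/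
  nabla_φ (X Y : Cₛ^∞⟮I; E, (TangentSpace I : M → Type _)⟯) (x : M) :
    g.nabla X (fun y ↦ φ y (Y y)) x - φ x (g.nabla X Y x) =
      r • (g.inner x (X x) (Y x) • ξ x - (ε * η x (Y x)) • X x)

end

end

section

variable {E : Type*} [NormedAddCommGroup E] [NormedSpace ℝ E] [FiniteDimensional ℝ E]
  {H : Type*} [TopologicalSpace H] {I : ModelWithCorners ℝ E H}
  {M : Type*} [TopologicalSpace M] [ChartedSpace H M] [IsManifold I ∞ M]

/-- A vector field that is smooth on an open neighbourhood of `x` agrees near `x` with a globally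
smooth vector field. -/
lemma exists_contMDiffSection_eventuallyEq [T2Space M] {Y : Π x : M, TangentSpace I x} {u : Set M}
    {x : M} (hu : IsOpen u) (hx : x ∈ u) (hY : CMDiff[u] ∞ (T% Y)) :
    ∃ Y' : Cₛ^∞⟮I; E, (TangentSpace I : M → Type _)⟯, ∀ᶠ y in 𝓝 x, Y' y = Y y := by
  obtain ⟨f, hf, -⟩ := (SmoothBumpFunction.nhds_basis_support (I := I)
    (hu.mem_nhds hx)).mem_iff.1 Filter.univ_mem
  refine ⟨⟨(f : M → ℝ) • Y,
    ContMDiffOn.smul_section_of_tsupport f.contMDiff.contMDiffOn hu hf hY⟩, ?_⟩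
  filter_upwards [f.eventuallyEq_one] with y hy
  change f y • Y y = Y y
  rw [hy, Pi.one_apply, one_smul]

/-- Every tangent vector is the value of a globally smooth vector field. -/
lemma exists_contMDiffSection_apply_eq [T2Space M] (x : M) (v : TangentSpace I x) :
    ∃ X : Cₛ^∞⟮I; E, (TangentSpace I : M → Type _)⟯, X x = v := by
  let e := trivializationAt E (TangentSpace I : M → Type _) x
  have hx : x ∈ e.baseSet := FiberBundle.mem_baseSet_trivializationAt' x
  have hs : CMDiff[e.baseSet] ∞ (T% (fun y ↦ ∑ i, (e.basisAt (Module.finBasis ℝ E) hx).repr v i •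
      e.localFrame (Module.finBasis ℝ E) i y)) :=
    ContMDiffOn.sum_section fun i _ ↦ ContMDiffOn.const_smul_section
      (e.contMDiffOn_localFrame_baseSet ∞ (Module.finBasis ℝ E) i)
  obtain ⟨X, hX⟩ := exists_contMDiffSection_eventuallyEq e.open_baseSet hx hs
  refine ⟨X, hX.self_of_nhds.trans ?_⟩
  simp only [e.localFrame_apply_of_mem_baseSet _ hx]
  exact (e.basisAt (Module.finBasis ℝ E) hx).sum_repr v

namespace SemiRiemannianMetric

variable (g : SemiRiemannianMetric I M)

lemma leviCivita_congr {Y Y' : Π x : M, TangentSpace I x} {x : M} (hY : MDiffAt (T% Y) x)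
    (hY' : MDiffAt (T% Y') x) (h : ∀ᶠ y in 𝓝 x, Y y = Y' y) :
    g.leviCivita Y x = g.leviCivita Y' x :=
  (g.leviCivita.isCovariantDerivativeOn (s := univ)).congr_of_eventuallyEq hY hY'
    Filter.univ_mem h

lemma leviCivita_const_smul (c : ℝ) {Y : Π x : M, TangentSpace I x} {x : M}
    (hY : MDiffAt (T% Y) x) : g.leviCivita (c • Y) x = c • g.leviCivita Y x :=
  (g.leviCivita.isCovariantDerivativeOn (s := univ)).smul_const c hY

/-- If `Z ↦ R(Z, X)Y` is given at `x` by an endomorphism `A` on vector fields smooth near `x`,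
then `ρ(X, Y)` is the trace of `A`. -/
lemma ricci_eq_trace {X Y : Π x : M, TangentSpace I x} {x : M}
    (A : TangentSpace I x →ₗ[ℝ] TangentSpace I x)
    (hA : ∀ (Z : Π x : M, TangentSpace I x) (u : Set M), IsOpen u → x ∈ u → CMDiff[u] ∞ (T% Z) →
      g.curvature Z X Y x = A (Z x)) :
    g.ricci X Y x = LinearMap.trace ℝ _ A := by
  let e := trivializationAt E (TangentSpace I : M → Type _) x
  have hx : x ∈ e.baseSet := FiberBundle.mem_baseSet_trivializationAt' x
  rw [LinearMap.trace_eq_matrix_trace ℝ (e.basisAt (Module.finBasis ℝ E) hx), Matrix.trace]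
  refine Finset.sum_congr rfl fun i _ ↦ ?_
  rw [e.localFrameCoeff_apply_of_mem_baseSet (Module.finBasis ℝ E) hx (g.curvature _ X Y) i,
    hA _ e.baseSet e.open_baseSet hx
      (e.contMDiffOn_localFrame_baseSet ∞ (Module.finBasis ℝ E) i),
    e.localFrame_apply_of_mem_baseSet _ hx, Matrix.diag_apply, LinearMap.toMatrix_apply]

end SemiRiemannianMetric

namespace IsRSasakian

variable {r ε : ℝ}
  {φ : Cₛ^∞⟮I; E →L[ℝ] E, fun x : M ↦ TangentSpace I x →L[ℝ] TangentSpace I x⟯}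
  {ξ : Cₛ^∞⟮I; E, (TangentSpace I : M → Type _)⟯}
  {η : Cₛ^∞⟮I; E →L[ℝ] ℝ, fun x : M ↦ TangentSpace I x →L[ℝ] ℝ⟯}
  {g : SemiRiemannianMetric I M}

lemma r_ne_zero (hS : IsRSasakian r ε φ ξ η g) : r ≠ 0 := by
  rcases hS.r_eq with h | h <;> simp [h]

lemma ε_mul_ε (hS : IsRSasakian r ε φ ξ η g) : ε * ε = 1 := by
  rcases hS.ε_eq with h | h <;> simp [h]

lemma ξ_ne_zero (hS : IsRSasakian r ε φ ξ η g) (x : M) : ξ x ≠ 0 := by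
  intro h
  have := hS.η_ξ x
  rw [h, map_zero] at this
  exact zero_ne_one this

lemma η_smul_φ_ξ (hS : IsRSasakian r ε φ ξ η g) (x : M) (v : TangentSpace I x) :
    η x v • φ x (ξ x) = η x (φ x v) • ξ x := by
  have h1 := hS.φ_φ x (φ x v)
  rw [hS.φ_φ x v, map_smul, map_add, map_neg, map_smul] at h1
  exact add_left_cancel (smul_right_injective _ hS.r_ne_zero h1)

lemma φ_ξ (hS : IsRSasakian r ε φ ξ η g) (x : M) : φ x (ξ x) = 0 := by
  have h1 : φ x (ξ x) = η x (φ x (ξ x)) • ξ x := by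
    rw [← hS.η_smul_φ_ξ, hS.η_ξ, one_smul]
  have h2 : φ x (φ x (ξ x)) = 0 := by rw [hS.φ_φ, hS.η_ξ]; simp
  rw [h1, map_smul, h1, smul_smul] at h2
  have h3 := (smul_eq_zero.1 h2).resolve_right (hS.ξ_ne_zero x)
  simp only [map_smul, hS.η_ξ, smul_eq_mul, mul_one] at h3
  rw [h1, mul_self_eq_zero.1 h3, zero_smul]

lemma η_φ (hS : IsRSasakian r ε φ ξ η g) (x : M) (v : TangentSpace I x) : η x (φ x v) = 0 := by
  have h := hS.η_smul_φ_ξ x v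
  rw [hS.φ_ξ, smul_zero] at h
  exact (smul_eq_zero.1 h.symm).resolve_right (hS.ξ_ne_zero x)

lemma inner_ξ (hS : IsRSasakian r ε φ ξ η g) (x : M) (v : TangentSpace I x) :
    g.inner x (ξ x) v = ε * η x v := by
  have h := hS.inner_φ_φ x (ξ x) v
  rw [hS.φ_ξ, map_zero, zero_apply, hS.η_ξ, mul_one] at h
  exact sub_eq_zero.1 ((mul_eq_zero.1 h.symm).resolve_left hS.r_ne_zero)

lemma inner_ξ_right (hS : IsRSasakian r ε φ ξ η g) (x : M) (v : TangentSpace I x) :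
    g.inner x v (ξ x) = ε * η x v := by
  rw [g.symm, hS.inner_ξ]

/-- The kernel of `φ` is spanned by `ξ`. -/
lemma eq_of_φ_eq_of_η_eq (hS : IsRSasakian r ε φ ξ η g) {x : M} {v w : TangentSpace I x}
    (hφ : φ x v = φ x w) (hη : η x v = η x w) : v = w := by
  have h := hS.φ_φ x v
  rw [hφ, hS.φ_φ x w, hη] at h
  exact (neg_injective (add_right_cancel (smul_right_injective _ hS.r_ne_zero h))).symm

lemma η_leviCivita_ξ (hS : IsRSasakian r ε φ ξ η g) (X : Cₛ^∞⟮I; E, (TangentSpace I : M → Type _)⟯)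
    (x : M) : η x (g.leviCivita ξ x (X x)) = 0 := by
  have hξ : MDiffAt (T% (ξ : Π y : M, TangentSpace I y)) x := ξ.mdifferentiableAt
  have h := g.mvfderiv_inner (X.mdifferentiableAt (x := x)) hξ hξ
  have hc : (fun y ↦ g.inner y (ξ y) (ξ y)) = fun _ ↦ ε := funext hS.inner_ξ_ξ
  rw [hc, mvfderiv_const, hS.inner_ξ, hS.inner_ξ_right] at h
  simp only [zero_apply] at h
  have hε : ε ≠ 0 := fun h0 ↦ by simpa [h0] using hS.ε_mul_ε
  exact (mul_eq_zero.1 (by linarith : ε * η x (g.leviCivita ξ x (X x)) = 0)).resolve_left hε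

/-- The covariant derivative of the characteristic vector field: `∇_v ξ = -ε φ v`. -/
lemma leviCivita_ξ [T2Space M] (hS : IsRSasakian r ε φ ξ η g) (x : M) (v : TangentSpace I x) :
    g.leviCivita ξ x v = -ε • φ x v := by
  obtain ⟨X, rfl⟩ := exists_contMDiffSection_apply_eq x v
  refine hS.eq_of_φ_eq_of_η_eq ?_ ?_
  · have h := hS.nabla_φ X ξ x
    have h0 : (fun y ↦ φ y (ξ y)) = (0 : Π y : M, TangentSpace I y) := funext hS.φ_ξ
    simp only [SemiRiemannianMetric.nabla] at h
    rw [h0, g.leviCivita.zero, hS.inner_ξ_right, hS.η_ξ, Pi.zero_apply, zero_apply, zero_sub] at h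
    rw [← neg_inj, h, map_smul, hS.φ_φ]
    module
  · rw [hS.η_leviCivita_ξ, map_smul, hS.η_φ, smul_zero]

lemma mdifferentiableAt_φ {Y : Π x : M, TangentSpace I x} {x : M} (hY : MDiffAt (T% Y) x) :
    MDiffAt (T% (fun y ↦ φ y (Y y))) x :=
  MDifferentiableAt.clm_bundle_apply (F₁ := E) (F₂ := E) φ.mdifferentiableAt hY

/-- The formula for `∇φ` on vector fields that are smooth near `x`. -/
lemma leviCivita_φ [T2Space M] (hS : IsRSasakian r ε φ ξ η g) {Y : Π x : M, TangentSpace I x}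
    {u : Set M} {x : M} (hu : IsOpen u) (hx : x ∈ u) (hY : CMDiff[u] ∞ (T% Y))
    (v : TangentSpace I x) :
    g.leviCivita (fun y ↦ φ y (Y y)) x v - φ x (g.leviCivita Y x v) =
      r • (g.inner x v (Y x) • ξ x - (ε * η x (Y x)) • v) := by
  obtain ⟨X, rfl⟩ := exists_contMDiffSection_apply_eq x v
  obtain ⟨Y', hY'⟩ := exists_contMDiffSection_eventuallyEq hu hx hY
  have hd : MDiffAt (T% Y) x := (hY.contMDiffAt (hu.mem_nhds hx)).mdifferentiableAt (by simp)
  have hd' : MDiffAt (T% (Y' : Π y : M, TangentSpace I y)) x := Y'.mdifferentiableAt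
  rw [← g.leviCivita_congr hd' hd hY', ← hY'.self_of_nhds,
    ← g.leviCivita_congr (mdifferentiableAt_φ (φ := φ) hd') (mdifferentiableAt_φ hd)
      (hY'.mono fun y hy ↦ congrArg (φ y) hy)]
  exact hS.nabla_φ X Y' x

/-- The curvature identity `R(X, Y)ξ = r (η(Y) X - η(X) Y)`. -/
lemma curvature_ξ [T2Space M] (hS : IsRSasakian r ε φ ξ η g) {X Y : Π x : M, TangentSpace I x}
    {u : Set M} {x : M} (hu : IsOpen u) (hx : x ∈ u) (hX : CMDiff[u] ∞ (T% X))
    (hY : CMDiff[u] ∞ (T% Y)) :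
    g.curvature X Y ξ x = r • (η x (Y x) • X x - η x (X x) • Y x) := by
  have hdX : MDiffAt (T% X) x := (hX.contMDiffAt (hu.mem_nhds hx)).mdifferentiableAt (by simp)
  have hdY : MDiffAt (T% Y) x := (hY.contMDiffAt (hu.mem_nhds hx)).mdifferentiableAt (by simp)
  have hξ (Z : Π x : M, TangentSpace I x) : g.nabla Z ξ = -ε • fun y ↦ φ y (Z y) :=
    funext fun y ↦ hS.leviCivita_ξ y (Z y)
  have hT := (CovariantDerivative.torsion_eq_zero_iff _).1 g.torsion_leviCivita hdX hdY
  have h1 := hS.leviCivita_φ hu hx hY (X x)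
  have h2 := hS.leviCivita_φ hu hx hX (Y x)
  rw [SemiRiemannianMetric.curvature, hξ, hξ, hξ, Pi.smul_apply, ← hT, map_sub,
    SemiRiemannianMetric.nabla, SemiRiemannianMetric.nabla,
    g.leviCivita_const_smul _ (mdifferentiableAt_φ hdY),
    g.leviCivita_const_smul _ (mdifferentiableAt_φ hdX), smul_apply, smul_apply,
    sub_eq_iff_eq_add.1 h1, sub_eq_iff_eq_add.1 h2, g.symm x (Y x) (X x)]
  rw [← one_smul ℝ (r • (η x (Y x) • X x - η x (X x) • Y x)), ← hS.ε_mul_ε]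
  module

end IsRSasakian

end


theorem mainTheorem6 (n : ℕ) {M : Type*} [TopologicalSpace M] [T2Space M]
    [ChartedSpace (EuclideanSpace ℝ (Fin (2 * n + 1))) M] [IsManifold (𝓡 (2 * n + 1)) ∞ M]
    (r ε : ℝ)
    (φ : Cₛ^∞⟮𝓡 (2 * n + 1);
      EuclideanSpace ℝ (Fin (2 * n + 1)) →L[ℝ] EuclideanSpace ℝ (Fin (2 * n + 1)),
      fun x : M ↦ TangentSpace (𝓡 (2 * n + 1)) x →L[ℝ] TangentSpace (𝓡 (2 * n + 1)) x⟯)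
    (ξ : Cₛ^∞⟮𝓡 (2 * n + 1); EuclideanSpace ℝ (Fin (2 * n + 1)),
      (TangentSpace (𝓡 (2 * n + 1)) : M → Type _)⟯)
    (η : Cₛ^∞⟮𝓡 (2 * n + 1); EuclideanSpace ℝ (Fin (2 * n + 1)) →L[ℝ] ℝ,
      fun x : M ↦ TangentSpace (𝓡 (2 * n + 1)) x →L[ℝ] ℝ⟯)
    (g : SemiRiemannianMetric (𝓡 (2 * n + 1)) M)
    (hS : IsRSasakian r ε φ ξ η g)
    (X : Cₛ^∞⟮𝓡 (2 * n + 1); EuclideanSpace ℝ (Fin (2 * n + 1)),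
      (TangentSpace (𝓡 (2 * n + 1)) : M → Type _)⟯) (x : M) :
    g.ricci X ξ x = 2 * n * r * η x (X x) := by
  let A : TangentSpace (𝓡 (2 * n + 1)) x →ₗ[ℝ] TangentSpace (𝓡 (2 * n + 1)) x :=
    r • (η x (X x) • LinearMap.id - (η x : _ →ₗ[ℝ] ℝ).smulRight (X x))
  have hA : g.ricci X ξ x = LinearMap.trace ℝ _ A := by
    refine g.ricci_eq_trace A fun Z u hu hx hZ ↦ ?_
    rw [hS.curvature_ξ hu hx hZ X.contMDiff.contMDiffOn]
    rfl
  have : FiniteDimensional ℝ (TangentSpace (𝓡 (2 * n + 1)) x) :=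
    inferInstanceAs (FiniteDimensional ℝ (EuclideanSpace ℝ (Fin (2 * n + 1))))
  have hd : Module.finrank ℝ (TangentSpace (𝓡 (2 * n + 1)) x) = 2 * n + 1 :=
    finrank_euclideanSpace_fin
  rw [hA]
  simp only [A, map_smul, map_sub, LinearMap.trace_id, hd, LinearMap.trace_smulRight]
  simp
  ring
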